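/- Let $d \ge 0$ and $n \ge 1$, let $E, F \subset \mathbb{R}^d$ be Lebesgue measurable sets of finite measure (bands), let $A_1,\dots,A_n$ be invertible real $d\times d$ matrices, and let $\beta_1,\dots,\beta_n,\gamma_1,\dots,\gamma_n \in \mathbb{R}^d$. Let $V_E$ be the space of $f \in L^2(\mathbb{R}^d)$ whose Fourier transform $\hat f(\xi) = \int f(x) e^{-2\pi i x\cdot \xi}\,dx$ vanishes almost everywhere outside $E$; each such $f$ is identified with its continuous representative. Define $V_F$ in the same way. Assume that the sampling transforms $$\Theta_A : V_E \to \bigoplus_{j=1}^n \ell^2(\mathbb{Z}^d),\quad f \mapsto \big((f(A_1 z+\beta_1))_{z},\dots,(f(A_n z+\beta_n))_{z}\big),$$ $$\Theta_B : V_F \to \bigoplus_{j=1}^n \ell^2(\mathbb{Z}^d),\quad g \mapsto \big((g(A_1 z+\gamma_1))_{z},\dots,(g(A_n z+\gamma_n))_{z}\big)$$ are well defined and bounded. The samples $\{A_j z+\beta_j\}$ and $\{A_j z+\gamma_j\}$ ($1 \le j\le n$, $z\in\mathbb{Z}^d$) are called orthogonal on the bands $E$ and $F$ if the ranges $\Theta_A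 V_E$ and $\Theta_B V_F$ are orthogonal in $\bigoplus_{j=1}^n \ell^2(\mathbb{Z}^d)$. Put $A_j' = (A_j^{*})^{-1}$ and $\Lambda = \bigcup_{j=1}^n A_j'\mathbb{Z}^d$, and for $\alpha\in\Lambda$ and $q \in \mathbb{R}^d$ let $$\mathcal{P}_\alpha = \{ j : A_j^{*}\alpha \in \mathbb{Z}^d\},\qquad I_{q,\alpha} = \{ j\in\mathcal{P}_\alpha : \gamma_j-\beta_j = q\}.$$ Let $m$ denote Lebesgue measure. Then the samples are orthogonal on the bands $E$ and $F$ if and only if for every $\alpha\in\Lambda$ at least one of the following holds: (1) $m(E\cap(F+\alpha)) = 0$; (2) $\sum_{j\in I_{q,\alpha}} |\det A_j|^{-1} e^{-2\pi i\gamma_j\cdot\alpha} = 0$ for all $q\in\mathbb{R}^d$. In particular, if the samples are orthogonal on $E$ and $F$, then $m(E\cap F) = 0$. -/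

import Mathlib

open MeasureTheory FourierTransform
open scoped ENNReal

noncomputable section

/-- The space `V_E` of band-limited functions with band `E`: the square-integrable `f` on `ℝ^d`
whose (`L²`) Fourier transform vanishes almost everywhere outside `E`. When `E` has finite measure,
every such `L²` class has exactly one continuous representative; the elements of `V_E` are taken
to be these representatives, so that they have values at points. -/
def bandSpace {d : ℕ} (E : Set (EuclideanSpace ℝ (Fin d))) :
    Submodule ℂ (EuclideanSpace ℝ (Fin d) → ℂ) where
  carrier := {f | Continuous f ∧ ∃ hf : MemLp f 2 volume,
    ∀ᵐ ξ ∂(volume : Measure (EuclideanSpace ℝ (Fin d))),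
      ξ ∉ E → (𝓕 (hf.toLp f) : Lp ℂ 2 (volume : Measure (EuclideanSpace ℝ (Fin d)))) ξ = 0}
  zero_mem' := by
    refine ⟨continuous_const, MemLp.zero, ?_⟩
    rw [MemLp.toLp_zero, FourierTransform.fourier_zero]
    filter_upwards [Lp.coeFn_zero ℂ 2 (volume : Measure (EuclideanSpace ℝ (Fin d)))] with ξ h _
    exact h
  add_mem' := by
    rintro f g ⟨hfc, hf, hf'⟩ ⟨hgc, hg, hg'⟩
    refine ⟨hfc.add hgc, hf.add hg, ?_⟩
    rw [MemLp.toLp_add hf hg, FourierTransform.fourier_add]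
    filter_upwards [Lp.coeFn_add (𝓕 (hf.toLp f)) (𝓕 (hg.toLp g)), hf', hg'] with ξ h h1 h2 hξ
    rw [h, Pi.add_apply, h1 hξ, h2 hξ, add_zero]
  smul_mem' := by
    rintro c f ⟨hfc, hf, hf'⟩
    refine ⟨hfc.const_smul c, hf.const_smul c, ?_⟩
    rw [MemLp.toLp_const_smul c hf, FourierTransform.fourier_smul]
    filter_upwards [Lp.coeFn_smul c (𝓕 (hf.toLp f)), hf'] with ξ h h1 hξ
    rw [h, Pi.smul_apply, h1 hξ, smul_zero]

/-- The point `A z + β` of the shifted lattice `A ℤ^d + β`. -/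
def samplePoint {d : ℕ} (A : Matrix (Fin d) (Fin d) ℝ) (β : EuclideanSpace ℝ (Fin d))
    (z : Fin d → ℤ) : EuclideanSpace ℝ (Fin d) :=
  WithLp.toLp 2 (A.mulVec fun i => (z i : ℝ)) + β

/-- The Hilbert space `ℓ²(ℤ^d) ⊕ ⋯ ⊕ ℓ²(ℤ^d)` (`n` summands). -/
abbrev SampleSpace (n d : ℕ) : Type :=
  PiLp 2 fun _ : Fin n => lp (fun _ : Fin d → ℤ => ℂ) 2

/-- The sampling transform `f ↦ (f(A_1 z + β_1), …, f(A_n z + β_n))` is bounded as a map from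
`V_E`, with the norm of `L²(ℝ^d)`, to `ℓ²(ℤ^d) ⊕ ⋯ ⊕ ℓ²(ℤ^d)`. -/
def SamplingBounded {n d : ℕ} (A : Fin n → Matrix (Fin d) (Fin d) ℝ)
    (β : Fin n → EuclideanSpace ℝ (Fin d)) (E : Set (EuclideanSpace ℝ (Fin d))) : Prop :=
  ∃ C : ℝ, ∀ f ∈ bandSpace E,
    (∀ j, Summable fun z : Fin d → ℤ => ‖f (samplePoint (A j) (β j) z)‖ ^ 2) ∧
    ∑ j, ∑' z : Fin d → ℤ, ‖f (samplePoint (A j) (β j) z)‖ ^ 2 ≤ C * ∫ x, ‖f x‖ ^ 2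

/-- A family of samples of an element of `V_E` is in `ℓ²(ℤ^d)` if the transform is bounded. -/
theorem SamplingBounded.memlp {n d : ℕ} {A : Fin n → Matrix (Fin d) (Fin d) ℝ}
    {β : Fin n → EuclideanSpace ℝ (Fin d)} {E : Set (EuclideanSpace ℝ (Fin d))}
    (h : SamplingBounded A β E) {f : EuclideanSpace ℝ (Fin d) → ℂ} (hf : f ∈ bandSpace E)
    (j : Fin n) : Memℓp (fun z : Fin d → ℤ => f (samplePoint (A j) (β j) z)) 2 := by
  obtain ⟨C, hC⟩ := h
  refine memℓp_gen ?_
  simpa using (hC f hf).1 j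

/-- The sampling transform `Θ : V_E → ℓ²(ℤ^d) ⊕ ⋯ ⊕ ℓ²(ℤ^d)`,
`f ↦ (f(A_1 z + β_1), …, f(A_n z + β_n))`. -/
def samplingTransform {n d : ℕ} {A : Fin n → Matrix (Fin d) (Fin d) ℝ}
    {β : Fin n → EuclideanSpace ℝ (Fin d)} {E : Set (EuclideanSpace ℝ (Fin d))}
    (h : SamplingBounded A β E) : bandSpace E →ₗ[ℂ] SampleSpace n d where
  toFun f := WithLp.toLp 2 fun j =>
    (⟨fun z => f.1 (samplePoint (A j) (β j) z), h.memlp f.2 j⟩ :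
      lp (fun _ : Fin d → ℤ => ℂ) 2)
  map_add' _ _ := rfl
  map_smul' _ _ := rfl

/-- The samples `{A_j z + β_j}` on the band `E` and `{B_j z + γ_j}` on the band `F`, with bounded
sampling transforms, are orthogonal: the ranges of the two transforms are orthogonal. -/
def OrthogonalSamples {n d : ℕ} {A B : Fin n → Matrix (Fin d) (Fin d) ℝ}
    {β γ : Fin n → EuclideanSpace ℝ (Fin d)} {E F : Set (EuclideanSpace ℝ (Fin d))}
    (hA : SamplingBounded A β E) (hB : SamplingBounded B γ F) : Prop :=
  LinearMap.range (samplingTransform hA) ⟂ LinearMap.range (samplingTransform hB)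

/-- `Λ = ⋃_j A_j' ℤ^d`, where `A' = (Aᵀ)⁻¹`. -/
def dualUnion {n d : ℕ} (A : Fin n → Matrix (Fin d) (Fin d) ℝ) :
    Set (EuclideanSpace ℝ (Fin d)) :=
  ⋃ j, Set.range fun z : Fin d → ℤ =>
    (WithLp.toLp 2 ((A j).transpose⁻¹.mulVec fun i => (z i : ℝ)) : EuclideanSpace ℝ (Fin d))

/-- `P_α = {j : A_jᵀ α ∈ ℤ^d}`. -/
def dualIndices {n d : ℕ} (A : Fin n → Matrix (Fin d) (Fin d) ℝ)
    (α : EuclideanSpace ℝ (Fin d)) : Set (Fin n) :=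
  {j | ∃ z : Fin d → ℤ, (A j).transpose.mulVec α.ofLp = fun i => (z i : ℝ)}

open Classical in
/-- `I_{q,α} = {j ∈ P_α : γ_j - β_j = q}`. -/
def shiftIndices {n d : ℕ} (A : Fin n → Matrix (Fin d) (Fin d) ℝ)
    (β γ : Fin n → EuclideanSpace ℝ (Fin d)) (q α : EuclideanSpace ℝ (Fin d)) :
    Finset (Fin n) :=
  Finset.univ.filter fun j => j ∈ dualIndices A α ∧ γ j - β j = q

end

/-! Write f = 𝓕⁻ φ and g = 𝓕⁻ ψ with φ in L²(E), ψ in L²(F); both are integrable because the bands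
have finite measure. With ξ = A'η the samples of f on A ℤ^d + β become |det A|⁻¹ times Fourier
integrals at integer frequencies, which see only a periodization. If φ and ψ have bounded support,
Parseval on the cube (`hasSum_cube_parseval`, `hasSum_samples`), summed over j, gives ∑_j ∑_z f(A_j
z + β_j) conj g(A_j z + γ_j) = ∑_{α ∈ Λ} ∫ φ(ξ) conj ψ(ξ+α) W_α(ξ) dξ, a finite sum, where W_α is a
trigonometric polynomial whose coefficients are the sums in condition (2)
(`inner_samplingTransform_eq_sum`).

Sufficiency: the term at α vanishes if (1) or (2) holds at -α. Bounded supports suffice, because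
cutting φ off to large balls converges in L² and the sampling transforms are bounded.

Necessity: Λ is locally finite, so φ and ψ can be carried by such a small piece H of E ∩ (F+α) and
its translate that only the term at -α survives. Taking φ = conj W on H makes this term ∫_H |W|², so
W vanishes on a set of positive measure, and then all its coefficients vanish
(`planeWave_coeff_eq_zero`).

At α = 0 condition (2) fails, being about sums of positive numbers, so (1) must hold there. -/

theorem continuous_neg_innerₗ {V : Type*} [NormedAddCommGroup V] [InnerProductSpace ℝ V] :
    Continuous fun p : V × V => (-innerₗ V) p.1 p.2 :=
  (continuous_inner (𝕜 := ℝ) (E := V)).neg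

/-! ### The inverse Fourier transform on L¹ ∩ L² -/

section L2Fourier

variable {V : Type*} [NormedAddCommGroup V] [InnerProductSpace ℝ V] [FiniteDimensional ℝ V]
  [MeasurableSpace V] [BorelSpace V]

/-- Makes the general results on `VectorFourier.fourierIntegral`, continuity and the Fubini flip,
apply to 𝓕⁻. -/
theorem fourierInv_eq_fourierIntegral_neg (φ : V → ℂ) :
    𝓕⁻ φ = VectorFourier.fourierIntegral Real.fourierChar volume (-innerₗ V) φ := by
  ext x
  simp [Real.fourierInv_eq, VectorFourier.fourierIntegral]

theorem continuous_fourierInv_of_integrable {φ : V → ℂ} (hφ1 : Integrable φ) :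
    Continuous (𝓕⁻ φ) := by
  rw [fourierInv_eq_fourierIntegral_neg]
  exact VectorFourier.fourierIntegral_continuous Real.continuous_fourierChar
    continuous_neg_innerₗ hφ1

theorem integral_fourierInv_mul_eq_flip {f g : V → ℂ} (hf : Integrable f) (hg : Integrable g) :
    ∫ ξ, 𝓕⁻ f ξ * g ξ = ∫ x, f x * 𝓕⁻ g x := by
  have h := VectorFourier.integral_fourierIntegral_smul_eq_flip (μ := (volume : Measure V))
    (ν := (volume : Measure V)) (L := -innerₗ V) (f := f) (g := g)
    Real.continuous_fourierChar continuous_neg_innerₗ hf hg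
  simpa [Real.fourierInv_eq, VectorFourier.fourierIntegral, real_inner_comm] using h

/-- The inverse Fourier transform on `L²` agrees with the integral on `L¹ ∩ L²`. -/
theorem Lp_fourierInv_ae_eq {φ : V → ℂ} (hφ : MemLp φ 2 volume) (hφ1 : Integrable φ) :
    (𝓕⁻ (hφ.toLp φ) : Lp ℂ 2 (volume : Measure V)) =ᵐ[volume] 𝓕⁻ φ := by
  -- Test against smooth compactly supported functions: the L² transform is the distributional one,
  -- which moves 𝓕⁻ onto the test function, and Fubini moves it back onto φ.
  apply ae_eq_of_integral_contDiff_smul_eq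
  · exact (Lp.memLp _).locallyIntegrable (by norm_num)
  · exact (continuous_fourierInv_of_integrable hφ1).locallyIntegrable
  · intro g g_smooth g_cpt
    have hg₁ : HasCompactSupport (Complex.ofRealCLM ∘ g) := g_cpt.comp_left rfl
    have hg₂ : ContDiff ℝ ((⊤ : ℕ∞) : WithTop ℕ∞) (Complex.ofRealCLM ∘ g) := by fun_prop
    set G : SchwartzMap V ℂ := hg₁.toSchwartzMap hg₂ with hG
    have h1 : ∀ h : V → ℂ, ∫ x, g x • h x = ∫ x, G x * h x := fun h => by
      simp [hG]
    rw [h1, h1]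
    have h2 := congrArg (fun T : TemperedDistribution V ℂ => T G)
      (Lp.fourierInv_toTemperedDistribution_eq (hφ.toLp φ))
    simp only [TemperedDistribution.fourierInv_apply, Lp.toTemperedDistribution_apply,
      smul_eq_mul] at h2
    rw [← h2]
    calc ∫ x, (𝓕⁻ G : SchwartzMap V ℂ) x * (hφ.toLp φ) x
        = ∫ x, 𝓕⁻ (G : V → ℂ) x * φ x := by
          apply integral_congr_ae
          filter_upwards [hφ.coeFn_toLp] with x hx
          rw [hx, SchwartzMap.fourierInv_coe]
      _ = _ := integral_fourierInv_mul_eq_flip G.integrable hφ1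

theorem integrable_of_memLp_of_ae_zero {φ : V → ℂ} {E : Set V} (hE : volume E < ∞)
    (hφ : MemLp φ 2 volume) (h0 : ∀ᵐ ξ, ξ ∉ E → φ ξ = 0) : Integrable φ := by
  -- The measurable hull has the same finite measure, and L² is contained in L¹ on it.
  set T := toMeasurable volume E
  have hT : MeasurableSet T := measurableSet_toMeasurable _ _
  have hTfin : volume T < ∞ := by rwa [measure_toMeasurable]
  have : Fact (volume T < ∞) := ⟨hTfin⟩
  have h1 : IntegrableOn φ T := (hφ.restrict T).integrable (by norm_num)
  refine (h1.integrable_indicator hT).congr ?_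
  filter_upwards [h0] with ξ hξ
  by_cases h : ξ ∈ T
  · simp [h]
  · rw [Set.indicator_of_notMem h, hξ fun h' => h (subset_toMeasurable _ _ h')]

theorem integral_norm_sq_toLp {φ : V → ℂ} (hφ : MemLp φ 2 volume) :
    ∫ x, ‖φ x‖ ^ 2 = ‖hφ.toLp φ‖ ^ 2 := by
  rw [← inner_self_eq_norm_sq (𝕜 := ℂ), L2.inner_def, ← integral_re]
  · apply integral_congr_ae
    filter_upwards [hφ.coeFn_toLp] with x hx
    rw [hx, inner_self_eq_norm_sq]
  · exact L2.integrable_inner _ _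

end L2Fourier

/-! ### Band-limited functions as inverse Fourier integrals -/

variable {d : ℕ} {E : Set (EuclideanSpace ℝ (Fin d))}

theorem fourierInv_memLp {φ : EuclideanSpace ℝ (Fin d) → ℂ} (hφ : MemLp φ 2 volume)
    (hφ1 : Integrable φ) : MemLp (𝓕⁻ φ) 2 volume :=
  (memLp_congr_ae (Lp_fourierInv_ae_eq hφ hφ1)).1 (Lp.memLp _)

theorem toLp_fourierInv {φ : EuclideanSpace ℝ (Fin d) → ℂ} (hφ : MemLp φ 2 volume)
    (hφ1 : Integrable φ) :
    (fourierInv_memLp hφ hφ1).toLp (𝓕⁻ φ) = 𝓕⁻ (hφ.toLp φ) := by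
  apply Lp.ext
  exact (MemLp.coeFn_toLp _).trans (Lp_fourierInv_ae_eq hφ hφ1).symm

theorem fourierInv_mem_bandSpace {φ : EuclideanSpace ℝ (Fin d) → ℂ} (hE : volume E < ∞)
    (hφ : MemLp φ 2 volume) (h0 : ∀ᵐ ξ, ξ ∉ E → φ ξ = 0) : 𝓕⁻ φ ∈ bandSpace E := by
  have hφ1 := integrable_of_memLp_of_ae_zero hE hφ h0
  refine ⟨continuous_fourierInv_of_integrable hφ1, fourierInv_memLp hφ hφ1, ?_⟩
  rw [toLp_fourierInv hφ hφ1, fourier_fourierInv_eq]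
  filter_upwards [hφ.coeFn_toLp, h0] with ξ h1 h2 h3
  rw [h1, h2 h3]

theorem integral_norm_sq_fourierInv {φ : EuclideanSpace ℝ (Fin d) → ℂ}
    (hφ : MemLp φ 2 volume) (hφ1 : Integrable φ) :
    ∫ x, ‖𝓕⁻ φ x‖ ^ 2 = ∫ ξ, ‖φ ξ‖ ^ 2 := by
  rw [integral_norm_sq_toLp (fourierInv_memLp hφ hφ1), integral_norm_sq_toLp hφ,
    toLp_fourierInv hφ hφ1, ← Lp.norm_fourier_eq, fourier_fourierInv_eq]

/-- Every band-limited function is the inverse Fourier integral of a function in `L²(E)`. -/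
theorem exists_fourierInv_eq {f : EuclideanSpace ℝ (Fin d) → ℂ} (hE : volume E < ∞)
    (hf : f ∈ bandSpace E) :
    ∃ φ : EuclideanSpace ℝ (Fin d) → ℂ, MemLp φ 2 volume ∧ (∀ᵐ ξ, ξ ∉ E → φ ξ = 0) ∧
      f = 𝓕⁻ φ := by
  obtain ⟨hc, hf2, h0⟩ := hf
  have hφ := Lp.memLp (𝓕 (hf2.toLp f))
  have hφ1 := integrable_of_memLp_of_ae_zero hE hφ h0
  refine ⟨_, hφ, h0, ?_⟩
  refine (Continuous.ae_eq_iff_eq volume hc (continuous_fourierInv_of_integrable hφ1)).1 ?_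
  refine hf2.coeFn_toLp.symm.trans (Filter.EventuallyEq.trans ?_ (Lp_fourierInv_ae_eq hφ hφ1))
  rw [Lp.toLp_coeFn, fourierInv_fourier_eq]

/-! ### Parseval's identity on the unit cube and for lattice samples -/

section Cube

open scoped ComplexConjugate

/-- The half-open unit cube. -/
def unitCube (d : ℕ) : Set (Fin d → ℝ) := {x | ∀ i, x i ∈ Set.Ioc 0 1}

/-- The character `x ↦ e^{2πi z·x}` of `ℝ^d` with integer frequency `z`. -/
noncomputable def latticeChar {d : ℕ} (z : Fin d → ℤ) (x : Fin d → ℝ) : ℂ :=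
  Complex.exp (2 * Real.pi * Complex.I * ((∑ i, (z i : ℝ) * x i : ℝ) : ℂ))

/-- An integer vector as a real vector. -/
def intVec {d : ℕ} (z : Fin d → ℤ) : Fin d → ℝ := fun i => (z i : ℝ)

variable {d : ℕ}

theorem continuous_latticeChar (z : Fin d → ℤ) : Continuous (latticeChar z) := by
  unfold latticeChar; fun_prop

theorem norm_latticeChar (z : Fin d → ℤ) (x : Fin d → ℝ) : ‖latticeChar z x‖ = 1 := by
  rw [latticeChar, show (2 * Real.pi * Complex.I * ((∑ i, (z i : ℝ) * x i : ℝ) : ℂ)) =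
    ((2 * Real.pi * (∑ i, (z i : ℝ) * x i) : ℝ) : ℂ) * Complex.I by push_cast; ring]
  exact Complex.norm_exp_ofReal_mul_I _

theorem latticeChar_add_intVec (z m : Fin d → ℤ) (x : Fin d → ℝ) :
    latticeChar z (x + intVec m) = latticeChar z x := by
  rw [latticeChar, latticeChar, Complex.exp_eq_exp_iff_exists_int]
  refine ⟨∑ i, z i * m i, ?_⟩
  simp only [intVec, Pi.add_apply, mul_add, Finset.sum_add_distrib]
  push_cast
  ring

theorem mFourier_coe (z : Fin d → ℤ) (x : Fin d → ℝ) :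
    UnitAddTorus.mFourier z (fun i => (x i : UnitAddCircle)) = latticeChar z x := by
  simp only [UnitAddTorus.mFourier, ContinuousMap.coe_mk, latticeChar, fourier_coe_apply]
  rw [← Complex.exp_sum]
  congr 1
  push_cast
  rw [Finset.mul_sum]
  refine Finset.sum_congr rfl fun i _ => ?_
  ring

theorem measurableSet_unitCube : MeasurableSet (unitCube d) :=
  MeasurableSet.univ_pi' fun _ => measurableSet_Ioc

section Torus

-- With the Haar probability measure on each circle, integrals over the torus are integrals over the
-- unit cube.
noncomputable local instance : MeasureSpace UnitAddCircle := ⟨AddCircle.haarAddCircle⟩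

local instance : Measure.IsAddHaarMeasure (volume : Measure UnitAddCircle) :=
  inferInstanceAs (Measure.IsAddHaarMeasure AddCircle.haarAddCircle)

local instance : IsProbabilityMeasure (volume : Measure UnitAddCircle) :=
  inferInstanceAs (IsProbabilityMeasure AddCircle.haarAddCircle)

/-- The function on the torus with given values on the half-open unit cube. -/
noncomputable def torusLift (u : (Fin d → ℝ) → ℂ) (t : UnitAddTorus (Fin d)) : ℂ :=
  u (UnitAddTorus.measurableEquivPiIoc 0 t).1

theorem torusLift_coe (u : (Fin d → ℝ) → ℂ) {x : Fin d → ℝ} (hx : x ∈ unitCube d) :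
    torusLift u (fun i => (x i : UnitAddCircle)) = u x := by
  have hx' : ∀ i, x i ∈ Set.Ioc ((0 : Fin d → ℝ) i) ((0 : Fin d → ℝ) i + 1) := by
    simpa [unitCube] using hx
  have := (UnitAddTorus.measurableEquivPiIoc (0 : Fin d → ℝ)).apply_symm_apply ⟨x, hx'⟩
  rw [UnitAddTorus.coe_symm_measurableEquivPiIoc_apply] at this
  rw [torusLift, this]

theorem setOf_Ioc_eq_unitCube :
    {x : Fin d → ℝ | ∀ i, x i ∈ Set.Ioc ((0 : Fin d → ℝ) i) ((0 : Fin d → ℝ) i + 1)} =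
      unitCube d := by
  simp [unitCube]

theorem memLp_torusLift {u : (Fin d → ℝ) → ℂ} (hu : MemLp u 2 (volume.restrict (unitCube d))) :
    MemLp (torusLift u) 2 volume := by
  rw [← setOf_Ioc_eq_unitCube] at hu
  exact hu.comp_measurePreserving ((measurePreserving_subtype_coe
    (MeasurableSet.univ_pi' fun _ => measurableSet_Ioc)).comp
      (UnitAddTorus.measurePreserving_equivPiIoc (0 : Fin d → ℝ)))

/-- The coefficient at a frequency integrates against the character of the opposite frequency; hence
the sign. -/
theorem mFourierCoeff_torusLift (u : (Fin d → ℝ) → ℂ) (z : Fin d → ℤ) :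
    UnitAddTorus.mFourierCoeff (torusLift u) (-z) =
      ∫ x in unitCube d, latticeChar z x * u x := by
  rw [UnitAddTorus.mFourierCoeff_eq_integral _ _ 0, setOf_Ioc_eq_unitCube, neg_neg]
  refine setIntegral_congr_fun measurableSet_unitCube fun x hx => ?_
  simp only [mFourier_coe, torusLift_coe u hx, smul_eq_mul]

theorem mFourierCoeff_congr_ae {f g : UnitAddTorus (Fin d) → ℂ} (h : f =ᵐ[volume] g)
    (z : Fin d → ℤ) : UnitAddTorus.mFourierCoeff f z = UnitAddTorus.mFourierCoeff g z := by
  apply integral_congr_ae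
  filter_upwards [h] with t ht
  rw [ht]

/-- Parseval's identity on the unit cube. -/
theorem hasSum_cube_parseval {u v : (Fin d → ℝ) → ℂ}
    (hu : MemLp u 2 (volume.restrict (unitCube d)))
    (hv : MemLp v 2 (volume.restrict (unitCube d))) :
    HasSum (fun z : Fin d → ℤ => (∫ x in unitCube d, latticeChar z x * u x) *
      conj (∫ x in unitCube d, latticeChar z x * v x))
      (∫ x in unitCube d, u x * conj (v x)) := by
  have hU := memLp_torusLift hu
  have hV := memLp_torusLift hv
  have h := UnitAddTorus.hasSum_prod_mFourierCoeff (hV.toLp _) (hU.toLp _)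
  have e : ∫ t, conj (hV.toLp _ t) * hU.toLp _ t = ∫ x in unitCube d, u x * conj (v x) := by
    rw [← setOf_Ioc_eq_unitCube]
    calc ∫ t, conj (hV.toLp _ t) * hU.toLp _ t
        = ∫ t, conj (torusLift v t) * torusLift u t := by
          apply integral_congr_ae
          filter_upwards [hV.coeFn_toLp, hU.coeFn_toLp] with t h1 h2
          rw [h1, h2]
      _ = _ := by
          rw [UnitAddTorus.integral_preimage _ 0, setOf_Ioc_eq_unitCube]
          refine setIntegral_congr_fun measurableSet_unitCube fun x hx => ?_
          simp only [torusLift_coe u hx, torusLift_coe v hx, mul_comm]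
  rw [e] at h
  refine ((Equiv.neg (Fin d → ℤ)).hasSum_iff.2 h).congr_fun fun z => ?_
  simp only [Function.comp_apply, Equiv.neg_apply]
  rw [mFourierCoeff_congr_ae hV.coeFn_toLp, mFourierCoeff_congr_ae hU.coeFn_toLp,
    mFourierCoeff_torusLift, mFourierCoeff_torusLift, mul_comm]

end Torus

theorem existsUnique_sub_intVec_mem_unitCube (x : Fin d → ℝ) :
    ∃! m : Fin d → ℤ, x - intVec m ∈ unitCube d := by
  -- The cube is open at 0 and closed at 1, so the integer part is a ceiling minus one.
  refine ⟨fun i => ⌈x i⌉ - 1, fun i => ?_, fun m hm => ?_⟩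
  · have h1 := Int.ceil_lt_add_one (x i)
    have h2 := Int.le_ceil (x i)
    simp only [intVec, Pi.sub_apply, Set.mem_Ioc]
    push_cast
    constructor <;> linarith
  · ext i
    have h := hm i
    simp only [intVec, Pi.sub_apply, Set.mem_Ioc] at h
    have : ⌈x i⌉ = m i + 1 := by
      rw [Int.ceil_eq_iff]
      push_cast
      constructor <;> linarith
    omega

/-- The integral of a function carried by finitely many lattice cubes, folded to one cube. -/
theorem integral_eq_sum_unitCube {w : (Fin d → ℝ) → ℂ} (hw : Integrable w)
    {M : Finset (Fin d → ℤ)} (hM : ∀ m, ∀ x ∈ unitCube d, w (x + intVec m) ≠ 0 → m ∈ M) :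
    ∫ x, w x = ∑ m ∈ M, ∫ x in unitCube d, w (x + intVec m) := by
  have h1 : ∀ m, ∫ x in unitCube d, w (x + intVec m) =
      ∫ x, (unitCube d).indicator (fun y => w (y + intVec m)) (x - intVec m) := fun m => by
    rw [integral_sub_right_eq_self (fun x =>
      (unitCube d).indicator (fun y => w (y + intVec m)) x), integral_indicator
      measurableSet_unitCube]
  simp_rw [h1]
  rw [← integral_finsetSum]
  -- Each x lies in exactly one translated cube, so at most one summand is nonzero; if its index is
  -- outside M, then w x = 0.
  · congr 1 with x
    obtain ⟨m, hm, hu⟩ := existsUnique_sub_intVec_mem_unitCube x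
    rw [Finset.sum_eq_single m]
    · simp [hm]
    · intro b _ hb
      exact Set.indicator_of_notMem (fun h => hb (hu b h)) _
    · intro hm'
      rw [Set.indicator_of_mem hm, sub_add_cancel]
      by_contra hne
      exact hm' (hM m _ hm (by rwa [sub_add_cancel]))
  · intro m _
    refine Integrable.comp_sub_right (f := (unitCube d).indicator fun y => w (y + intVec m)) ?_ _
    exact (hw.comp_add_right _).indicator measurableSet_unitCube

/-- Parseval's identity for the samples on `ℤ^d` of Fourier integrals of two compactly supported
functions: the samples see the periodizations of the functions. -/
theorem hasSum_lattice_parseval {u v : (Fin d → ℝ) → ℂ} (hu : MemLp u 2 volume)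
    (hv : MemLp v 2 volume) (hu1 : Integrable u) (hv1 : Integrable v) {M : Finset (Fin d → ℤ)}
    (hMu : ∀ m, ∀ x ∈ unitCube d, u (x + intVec m) ≠ 0 → m ∈ M)
    (hMv : ∀ m, ∀ x ∈ unitCube d, v (x + intVec m) ≠ 0 → m ∈ M)
    {K : Finset (Fin d → ℤ)} (hK : ∀ k x, u x ≠ 0 → v (x + intVec k) ≠ 0 → k ∈ K) :
    HasSum (fun z : Fin d → ℤ => (∫ x, latticeChar z x * u x) *
      conj (∫ x, latticeChar z x * v x))
      (∑ k ∈ K, ∫ x, u x * conj (v (x + intVec k))) := by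
  have htr : ∀ {w : (Fin d → ℝ) → ℂ} (m : Fin d → ℤ), MemLp w 2 volume →
      MemLp (fun x => w (x + intVec m)) 2 volume := fun m hw =>
    hw.comp_measurePreserving (measurePreserving_add_right volume (intVec m))
  have hper : ∀ {w : (Fin d → ℝ) → ℂ}, MemLp w 2 volume →
      MemLp (fun x => ∑ m ∈ M, w (x + intVec m)) 2 (volume.restrict (unitCube d)) := fun hw =>
    (memLp_finsetSum M fun m _ => htr m hw).restrict _
  have hcoef : ∀ {w : (Fin d → ℝ) → ℂ}, Integrable w →
      (∀ m, ∀ x ∈ unitCube d, w (x + intVec m) ≠ 0 → m ∈ M) → ∀ z : Fin d → ℤ,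
      ∫ x, latticeChar z x * w x =
        ∫ x in unitCube d, latticeChar z x * ∑ m ∈ M, w (x + intVec m) := by
    intro w hw hwM z
    have hint : Integrable fun x => latticeChar z x * w x :=
      hw.bdd_mul (c := 1) (continuous_latticeChar z).aestronglyMeasurable
        (Filter.Eventually.of_forall fun x => (norm_latticeChar z x).le)
    rw [integral_eq_sum_unitCube hint fun m x hx h => hwM m x hx (right_ne_zero_of_mul h)]
    simp_rw [Finset.mul_sum]
    rw [integral_finsetSum]
    · simp_rw [latticeChar_add_intVec]
    · intro m _
      have := (hint.comp_add_right (intVec m)).integrableOn (s := unitCube d)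
      simpa only [latticeChar_add_intVec] using this.integrable
  have hprod : ∀ m l : Fin d → ℤ,
      Integrable fun x => u (x + intVec m) * conj (v (x + intVec l)) := fun m l =>
    (htr m hu).integrable_mul (htr l hv).star
  have h := hasSum_cube_parseval (hper hu) (hper hv)
  simp_rw [← hcoef hu1 hMu, ← hcoef hv1 hMv] at h
  convert h using 1
  simp_rw [map_sum, Finset.sum_mul_sum]
  rw [integral_finsetSum _ fun m _ => integrable_finsetSum _ fun l _ =>
    (hprod m l).integrableOn]
  have hk : ∀ k ∈ K, ∫ x, u x * conj (v (x + intVec k)) =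
      ∑ m ∈ M, ∫ x in unitCube d, u (x + intVec m) * conj (v (x + intVec m + intVec k)) := by
    intro k _
    refine integral_eq_sum_unitCube (w := fun x => u x * conj (v (x + intVec k))) ?_
      fun m x hx h => hMu m x hx (left_ne_zero_of_mul h)
    exact hu.integrable_mul (htr k hv).star
  rw [Finset.sum_congr rfl hk, Finset.sum_comm]
  refine Finset.sum_congr rfl fun m _ => ?_
  rw [integral_finsetSum _ fun l _ => (hprod m l).integrableOn]
  have hadd : ∀ (x : Fin d → ℝ) (a b : Fin d → ℤ),
      x + intVec a + intVec b = x + intVec (a + b) := fun x a b => by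
    ext i; simp [intVec, add_assoc]
  have hex : ∀ {w : (Fin d → ℝ) → ℂ}, ∫ x in unitCube d, w x ≠ 0 → ∃ x ∈ unitCube d, w x ≠ 0 := by
    intro w hw
    by_contra! hcon
    exact hw (by rw [setIntegral_congr_fun measurableSet_unitCube hcon]; simp)
  -- For fixed m, the pair of cubes (m, l) contributes to the shift k = l - m. The index sets M and
  -- K need to correspond only where the integrals are nonzero.
  refine Finset.sum_bij_ne_zero (fun k _ _ => m + k) ?_ ?_ ?_ ?_
  · intro k _ hne
    obtain ⟨x, hx, hx'⟩ := hex hne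
    refine hMv _ x hx ?_
    rw [← hadd]
    intro h0
    simp [h0] at hx'
  · intro a _ _ b _ _ hab
    exact add_left_cancel hab
  · intro l _ hne
    obtain ⟨x, hx, hx'⟩ := hex hne
    refine ⟨l - m, hK _ (x + intVec m) (left_ne_zero_of_mul hx') ?_, ?_, add_sub_cancel _ _⟩
    · rw [hadd, add_sub_cancel]
      intro h0
      simp [h0] at hx'
    · simpa only [hadd, add_sub_cancel] using hne
  · intro k _ _
    simp only [hadd]

end Cube

/-! ### Samples on one shifted lattice and its dual -/

section Pairing

open scoped ComplexConjugate

variable {d : ℕ}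

/-- The map `η ↦ (Aᵀ)⁻¹ η`. -/
noncomputable def dualMap (A : Matrix (Fin d) (Fin d) ℝ) (η : Fin d → ℝ) :
    EuclideanSpace ℝ (Fin d) := WithLp.toLp 2 (A.transpose⁻¹.mulVec η)

/-- The plane wave `ξ ↦ e^{2πi β·ξ}`. -/
noncomputable def planeWave (β ξ : EuclideanSpace ℝ (Fin d)) : ℂ :=
  Complex.exp (2 * Real.pi * Complex.I * ((inner ℝ β ξ : ℝ) : ℂ))

theorem continuous_planeWave (β : EuclideanSpace ℝ (Fin d)) : Continuous (planeWave β) := by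
  unfold planeWave; fun_prop

theorem norm_planeWave (β ξ : EuclideanSpace ℝ (Fin d)) : ‖planeWave β ξ‖ = 1 := by
  rw [planeWave, show (2 * Real.pi * Complex.I * ((inner ℝ β ξ : ℝ) : ℂ)) =
    ((2 * Real.pi * inner ℝ β ξ : ℝ) : ℂ) * Complex.I by push_cast; ring]
  exact Complex.norm_exp_ofReal_mul_I _

theorem planeWave_add_right (β ξ η : EuclideanSpace ℝ (Fin d)) :
    planeWave β (ξ + η) = planeWave β ξ * planeWave β η := by
  rw [planeWave, planeWave, planeWave, ← Complex.exp_add, inner_add_right]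
  push_cast; ring_nf

theorem planeWave_add_left (β γ ξ : EuclideanSpace ℝ (Fin d)) :
    planeWave (β + γ) ξ = planeWave β ξ * planeWave γ ξ := by
  rw [planeWave, planeWave, planeWave, ← Complex.exp_add, inner_add_left]
  push_cast; ring_nf

theorem conj_planeWave (β ξ : EuclideanSpace ℝ (Fin d)) :
    conj (planeWave β ξ) = planeWave (-β) ξ := by
  rw [planeWave, planeWave, ← Complex.exp_conj, inner_neg_left]
  simp [Complex.conj_ofReal, map_ofNat]

theorem conj_planeWave' (β ξ : EuclideanSpace ℝ (Fin d)) :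
    conj (planeWave β ξ) = planeWave β (-ξ) := by
  rw [conj_planeWave, planeWave, planeWave, inner_neg_left, inner_neg_right]

variable {A : Matrix (Fin d) (Fin d) ℝ}

theorem continuous_dualMap (A : Matrix (Fin d) (Fin d) ℝ) : Continuous (dualMap A) := by
  unfold dualMap
  exact (PiLp.continuous_toLp 2 _).comp (continuous_const.matrix_mulVec continuous_id)

theorem dualMap_add (A : Matrix (Fin d) (Fin d) ℝ) (x y : Fin d → ℝ) :
    dualMap A (x + y) = dualMap A x + dualMap A y := by
  simp [dualMap, Matrix.mulVec_add]

theorem isUnit_det_transpose (hA : IsUnit A) : IsUnit A.transpose.det := by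
  rw [Matrix.det_transpose]
  exact (Matrix.isUnit_iff_isUnit_det A).1 hA

theorem transpose_mulVec_dualMap (hA : IsUnit A) (η : Fin d → ℝ) :
    A.transpose.mulVec (dualMap A η).ofLp = η := by
  simp [dualMap, Matrix.mulVec_mulVec, Matrix.mul_nonsing_inv _ (isUnit_det_transpose hA)]

theorem dualMap_transpose_mulVec (hA : IsUnit A) (α : EuclideanSpace ℝ (Fin d)) :
    dualMap A (A.transpose.mulVec α.ofLp) = α := by
  simp [dualMap, Matrix.mulVec_mulVec, Matrix.nonsing_inv_mul _ (isUnit_det_transpose hA)]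

theorem dualMap_injective (hA : IsUnit A) : Function.Injective (dualMap A) := fun x y h => by
  rw [← transpose_mulVec_dualMap hA x, h, transpose_mulVec_dualMap hA]

/-- The push-forward under (Aᵀ)⁻¹ divides volume by its determinant, hence the factor |det A|. -/
theorem measurePreserving_dualMap (hA : IsUnit A) :
    MeasurePreserving (dualMap A) volume (ENNReal.ofReal |A.det| • volume) := by
  have hdet : A.transpose⁻¹.det ≠ 0 := by
    rw [Matrix.det_nonsing_inv, Ring.inverse_eq_inv']
    exact inv_ne_zero (isUnit_det_transpose hA).ne_zero
  have h1 : MeasurePreserving (Matrix.toLin' A.transpose⁻¹) volume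
      (ENNReal.ofReal |A.det| • volume) := by
    refine ⟨(continuous_const.matrix_mulVec continuous_id).measurable, ?_⟩
    rw [Real.map_matrix_volume_pi_eq_smul_volume_pi hdet]
    simp [Matrix.det_nonsing_inv]
  exact ((PiLp.volume_preserving_toLp (Fin d)).smul_measure (ENNReal.ofReal |A.det|)).comp h1

theorem measurableEmbedding_dualMap (hA : IsUnit A) : MeasurableEmbedding (dualMap A) :=
  (continuous_dualMap A).measurableEmbedding (dualMap_injective hA)

theorem integral_comp_dualMap (hA : IsUnit A) (w : EuclideanSpace ℝ (Fin d) → ℂ) :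
    ∫ η, w (dualMap A η) = ((|A.det| : ℝ) : ℂ) * ∫ ξ, w ξ := by
  rw [(measurePreserving_dualMap hA).integral_comp (measurableEmbedding_dualMap hA),
    integral_smul_measure, ENNReal.toReal_ofReal (abs_nonneg _), Complex.real_smul]

theorem memLp_comp_dualMap (hA : IsUnit A) {w : EuclideanSpace ℝ (Fin d) → ℂ} {p : ℝ≥0∞}
    (hw : MemLp w p volume) : MemLp (fun η => w (dualMap A η)) p volume :=
  (hw.smul_measure ENNReal.ofReal_ne_top).comp_measurePreserving (measurePreserving_dualMap hA)

/-- Duality: (Aᵀ)⁻¹η · Az = η · z. This turns sampling on A ℤ^d into integer frequencies in η. -/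
theorem inner_dualMap_mulVec (hA : IsUnit A) (η : Fin d → ℝ) (z : Fin d → ℤ) :
    inner ℝ (dualMap A η) (WithLp.toLp 2 (A.mulVec fun i => (z i : ℝ))) =
      ∑ i, (z i : ℝ) * η i := by
  have h : inner ℝ (dualMap A η) (WithLp.toLp 2 (A.mulVec fun i => (z i : ℝ))) =
      (A.mulVec fun i => (z i : ℝ)) ⬝ᵥ (dualMap A η).ofLp := by
    rw [EuclideanSpace.inner_eq_star_dotProduct]; simp
  rw [h, ← Matrix.vecMul_transpose, ← Matrix.dotProduct_mulVec, transpose_mulVec_dualMap hA]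
  rfl

theorem latticeChar_mul_planeWave (hA : IsUnit A) (β : EuclideanSpace ℝ (Fin d))
    (η : Fin d → ℝ) (z : Fin d → ℤ) :
    planeWave (samplePoint A β z) (dualMap A η) =
      latticeChar z η * planeWave β (dualMap A η) := by
  rw [samplePoint, planeWave_add_left]
  congr 1
  rw [planeWave, real_inner_comm, inner_dualMap_mulVec hA, latticeChar]

theorem fourierInv_apply_eq (φ : EuclideanSpace ℝ (Fin d) → ℂ) (x : EuclideanSpace ℝ (Fin d)) :
    𝓕⁻ φ x = ∫ ξ, planeWave x ξ * φ ξ := by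
  rw [Real.fourierInv_eq']
  congr 1 with ξ
  rw [planeWave, smul_eq_mul, real_inner_comm]
  push_cast
  ring_nf

theorem fourierInv_samplePoint (hA : IsUnit A) (β : EuclideanSpace ℝ (Fin d))
    (φ : EuclideanSpace ℝ (Fin d) → ℂ) (z : Fin d → ℤ) :
    𝓕⁻ φ (samplePoint A β z) = ((|A.det|⁻¹ : ℝ) : ℂ) *
      ∫ η, latticeChar z η * (planeWave β (dualMap A η) * φ (dualMap A η)) := by
  have h0 : ((|A.det| : ℝ) : ℂ) ≠ 0 := by
    exact_mod_cast abs_ne_zero.2 ((Matrix.isUnit_iff_isUnit_det A).1 hA).ne_zero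
  simp_rw [← mul_assoc, ← latticeChar_mul_planeWave hA]
  rw [integral_comp_dualMap hA (fun ξ => planeWave (samplePoint A β z) ξ * φ ξ),
    fourierInv_apply_eq, ← mul_assoc]
  push_cast
  rw [inv_mul_cancel₀ h0, one_mul]

theorem finite_intVec_mem_of_isBounded {S : Set (Fin d → ℝ)} (hS : Bornology.IsBounded S) :
    {m : Fin d → ℤ | ∃ x ∈ unitCube d, x + intVec m ∈ S}.Finite := by
  obtain ⟨r, hr⟩ := hS.subset_closedBall 0
  refine (Set.finite_Icc (fun _ : Fin d => -(⌈r⌉ + 1)) (fun _ : Fin d => ⌈r⌉ + 1)).subset ?_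
  rintro m ⟨x, hx, hxm⟩
  have h := hr hxm
  have h0 : 0 ≤ r := dist_nonneg.trans h
  rw [mem_closedBall_zero_iff, pi_norm_le_iff_of_nonneg h0] at h
  have hc := Int.le_ceil r
  refine ⟨fun i => ?_, fun i => ?_⟩
  all_goals
    have h1 := abs_le.1 (h i)
    have h2 := hx i
    simp only [intVec, Pi.add_apply, Set.mem_Ioc] at h1 h2
    rify
    linarith [h1.1, h1.2, h2.1, h2.2]

theorem isBounded_preimage_dualMap (hA : IsUnit A) {S : Set (EuclideanSpace ℝ (Fin d))}
    (hS : Bornology.IsBounded S) : Bornology.IsBounded (dualMap A ⁻¹' S) := by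
  obtain ⟨r, hr⟩ := hS.subset_closedBall 0
  have hcpt := isCompact_closedBall (0 : EuclideanSpace ℝ (Fin d)) r
  have hc : Continuous fun α : EuclideanSpace ℝ (Fin d) => A.transpose.mulVec α.ofLp :=
    continuous_const.matrix_mulVec (PiLp.continuous_ofLp 2 _)
  refine (hcpt.image hc).isBounded.subset fun η hη => ?_
  exact ⟨dualMap A η, hr hη, transpose_mulVec_dualMap hA η⟩

theorem finite_dualMap_intVec_mem (hA : IsUnit A) {S : Set (EuclideanSpace ℝ (Fin d))}
    (hS : Bornology.IsBounded S) : {k : Fin d → ℤ | dualMap A (intVec k) ∈ S}.Finite := by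
  have h := isBounded_preimage_dualMap hA hS
  -- The all-ones vector lies in the half-open cube and serves as base point, so the set is
  -- translated by it.
  have h' : Bornology.IsBounded ((fun x : Fin d → ℝ => x - 1) ⁻¹' (dualMap A ⁻¹' S)) := by
    have := (isometry_add_right (1 : Fin d → ℝ)).lipschitz.isBounded_image h
    refine this.subset fun x hx => ⟨x - 1, hx, by simp⟩
  refine (finite_intVec_mem_of_isBounded h').subset fun k hk => ?_
  refine ⟨1, fun i => by simp, ?_⟩
  simpa using hk

theorem intVec_injective : Function.Injective (intVec (d := d)) := fun a b h => by
  ext i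
  have := congrFun h i
  simpa [intVec] using this

open Classical in
/-- The correlation of the samples on `A ℤ^d + β` and on `A ℤ^d + γ` of two functions with
compactly supported Fourier transforms. -/
theorem hasSum_samples {β γ : EuclideanSpace ℝ (Fin d)} (hA : IsUnit A)
    {φ ψ : EuclideanSpace ℝ (Fin d) → ℂ} (hφ : MemLp φ 2 volume) (hψ : MemLp ψ 2 volume)
    (hφ1 : Integrable φ) (hψ1 : Integrable ψ)
    (hφb : Bornology.IsBounded (Function.support φ))
    (hψb : Bornology.IsBounded (Function.support ψ))
    {R : Finset (EuclideanSpace ℝ (Fin d))}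
    (hR : ∀ k ξ, φ ξ ≠ 0 → ψ (ξ + dualMap A (intVec k)) ≠ 0 → dualMap A (intVec k) ∈ R) :
    HasSum (fun z : Fin d → ℤ => 𝓕⁻ φ (samplePoint A β z) * conj (𝓕⁻ ψ (samplePoint A γ z)))
      (∑ α ∈ R, if α ∈ Set.range (fun k => dualMap A (intVec k)) then
        ∫ ξ, ((|A.det|⁻¹ : ℝ) : ℂ) * (planeWave β ξ * φ ξ) *
          conj (planeWave γ (ξ + α) * ψ (ξ + α)) else 0) := by
  set u : (Fin d → ℝ) → ℂ := fun η => planeWave β (dualMap A η) * φ (dualMap A η) with hu_def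
  set v : (Fin d → ℝ) → ℂ := fun η => planeWave γ (dualMap A η) * ψ (dualMap A η) with hv_def
  have hmod : ∀ {p : ℝ≥0∞} (δ : EuclideanSpace ℝ (Fin d)) {w : EuclideanSpace ℝ (Fin d) → ℂ},
      MemLp w p volume →
      MemLp (fun η => planeWave δ (dualMap A η) * w (dualMap A η)) p volume := by
    intro p δ w hw
    refine (memLp_comp_dualMap hA hw).of_le ?_ (Filter.Eventually.of_forall fun η => ?_)
    · exact ((continuous_planeWave δ).comp (continuous_dualMap A)).aestronglyMeasurable.mul
        (memLp_comp_dualMap hA hw).1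
    · simp [norm_planeWave]
  have hfin : ∀ {w : EuclideanSpace ℝ (Fin d) → ℂ},
      Bornology.IsBounded (Function.support w) → {m : Fin d → ℤ | ∃ x ∈ unitCube d,
        x + intVec m ∈ dualMap A ⁻¹' Function.support w}.Finite := fun hw =>
    finite_intVec_mem_of_isBounded (isBounded_preimage_dualMap hA hw)
  have hinj : Function.Injective fun k : Fin d → ℤ => dualMap A (intVec k) :=
    (dualMap_injective hA).comp intVec_injective
  have h := hasSum_lattice_parseval (u := u) (v := v) (hmod β hφ) (hmod γ hψ)
    (memLp_one_iff_integrable.1 (hmod β (memLp_one_iff_integrable.2 hφ1)))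
    (memLp_one_iff_integrable.1 (hmod γ (memLp_one_iff_integrable.2 hψ1)))
    (M := (hfin hφb).toFinset ∪ (hfin hψb).toFinset)
    (fun m x hx hne => Finset.mem_union_left _ <| (Set.Finite.mem_toFinset _).2
      ⟨x, hx, right_ne_zero_of_mul hne⟩)
    (fun m x hx hne => Finset.mem_union_right _ <| (Set.Finite.mem_toFinset _).2
      ⟨x, hx, right_ne_zero_of_mul hne⟩)
    (K := R.preimage (fun k => dualMap A (intVec k)) hinj.injOn)
    (fun k x hux hvx => by
      rw [Finset.mem_preimage]
      refine hR k (dualMap A x) (right_ne_zero_of_mul hux) ?_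
      rw [← dualMap_add]
      exact right_ne_zero_of_mul hvx)
  have h' := h.mul_left (((|A.det|⁻¹ : ℝ) : ℂ) * ((|A.det|⁻¹ : ℝ) : ℂ))
  have h0 : ((|A.det| : ℝ) : ℂ) ≠ 0 := by
    exact_mod_cast abs_ne_zero.2 ((Matrix.isUnit_iff_isUnit_det A).1 hA).ne_zero
  -- The two samples contribute |det A|⁻², and the change of variables back to ξ gives |det A|,
  -- leaving one factor |det A|⁻¹. The `if` discards points of R off the dual lattice of A, so one R
  -- can serve several matrices.
  have e : (∑ α ∈ R, if α ∈ Set.range (fun k => dualMap A (intVec k)) then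
        ∫ ξ, ((|A.det|⁻¹ : ℝ) : ℂ) * (planeWave β ξ * φ ξ) *
          conj (planeWave γ (ξ + α) * ψ (ξ + α)) else 0) =
      ((|A.det|⁻¹ : ℝ) : ℂ) * ((|A.det|⁻¹ : ℝ) : ℂ) *
        ∑ k ∈ R.preimage (fun k => dualMap A (intVec k)) hinj.injOn,
          ∫ x, u x * conj (v (x + intVec k)) := by
    rw [← Finset.sum_filter, ← Finset.sum_preimage' (fun k => dualMap A (intVec k)) R hinj.injOn,
      Finset.mul_sum]
    refine Finset.sum_congr rfl fun k _ => ?_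
    have := integral_comp_dualMap hA fun ξ => (planeWave β ξ * φ ξ) *
      conj (planeWave γ (ξ + dualMap A (intVec k)) * ψ (ξ + dualMap A (intVec k)))
    simp only [hu_def, hv_def, dualMap_add]
    rw [this]
    simp only [mul_assoc]
    rw [integral_const_mul]
    push_cast
    field_simp
  rw [e]
  refine h'.congr_fun fun z => ?_
  rw [fourierInv_samplePoint hA, fourierInv_samplePoint hA, map_mul, Complex.conj_ofReal]
  ring
end Pairing

/-! ### Trigonometric polynomials vanishing on a set of positive measure -/

section TrigonometricPolynomial

open scoped Topology

variable {d : ℕ}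

/-- A set of positive measure meets its small translates in positive measure. -/
theorem eventually_measure_inter_translate_ne_zero {V : Type*} [NormedAddCommGroup V]
    [InnerProductSpace ℝ V] [FiniteDimensional ℝ V] [MeasurableSpace V] [BorelSpace V] {Z : Set V}
    (hZ : MeasurableSet Z) (hpos : volume Z ≠ 0) :
    ∀ᶠ h in 𝓝 (0 : V), volume (Z ∩ (fun x => x + h) ⁻¹' Z) ≠ 0 := by
  -- For Y of finite measure, the symmetric difference with a translate tends to measure 0; were Y
  -- and its translate essentially disjoint, it would have measure at least that of Y.
  obtain ⟨Y, hY, hYZ, hY0, hYfin⟩ := Measure.exists_subset_measure_lt_top hZ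
    (pos_iff_ne_zero.2 hpos)
  let f : V → C(V, V) := fun h => ⟨fun x => x + h, by fun_prop⟩
  have hf : Continuous f := ContinuousMap.continuous_of_continuous_uncurry f (by
    simp only [Function.uncurry_def, f, ContinuousMap.coe_mk]; fun_prop)
  have ht := tendsto_measure_symmDiff_preimage_nhds_zero (μ := (volume : Measure V))
    (ν := (volume : Measure V)) (hf.tendsto 0)
    (Filter.Eventually.of_forall fun h => measurePreserving_add_right volume h)
    (measurePreserving_add_right volume (0 : V)) hY.nullMeasurableSet hYfin.ne
  filter_upwards [ht.eventually_lt_const hY0] with h hh h0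
  have h1 : volume (Y ∩ (fun x => x + h) ⁻¹' Y) = 0 :=
    measure_mono_null (Set.inter_subset_inter hYZ (Set.preimage_mono hYZ)) h0
  refine hh.not_ge ?_
  have hf0 : (f 0 : V → V) ⁻¹' Y = Y := by ext x; simp [f]
  rw [hf0]
  calc volume Y ≤ volume (Y ∩ (fun x => x + h) ⁻¹' Y) +
        volume (Y \ (fun x => x + h) ⁻¹' Y) := measure_le_inter_add_sdiff _ _ _
    _ = volume (Y \ (fun x => x + h) ⁻¹' Y) := by rw [h1, zero_add]
    _ ≤ _ := measure_mono (Set.subset_union_right)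

/-- Along t(p - q) with small t > 0 the phases differ by t|p - q|², which lies strictly between 0
and 1 if p ≠ q and so is not an integer. -/
theorem planeWave_eq_of_eventually_eq {p q : EuclideanSpace ℝ (Fin d)}
    (h : ∀ᶠ x in 𝓝 (0 : EuclideanSpace ℝ (Fin d)), planeWave p x = planeWave q x) : p = q := by
  by_contra hne
  set r := p - q with hr
  have hr0 : 0 < inner ℝ r r := real_inner_self_pos.2 (sub_ne_zero.2 hne)
  have ht : Filter.Tendsto (fun t : ℝ => t • r) (𝓝[>] 0) (𝓝 0) := by
    have : Continuous fun t : ℝ => t • r := by fun_prop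
    simpa using (this.tendsto 0).mono_left nhdsWithin_le_nhds
  have hsmall : ∀ᶠ t : ℝ in 𝓝[>] 0, t * inner ℝ r r < 1 := by
    have : Continuous fun t : ℝ => t * inner ℝ r r := by fun_prop
    exact ((this.tendsto 0).mono_left nhdsWithin_le_nhds).eventually_lt_const (by simp)
  obtain ⟨t, h1, h2, h3⟩ :=
    ((ht.eventually h).and (hsmall.and self_mem_nhdsWithin)).exists
  have h4 : planeWave r (t • r) = 1 := by
    have h5 : planeWave p (t • r) = planeWave r (t • r) * planeWave q (t • r) := by
      rw [← planeWave_add_left, hr, sub_add_cancel]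
    have h6 : planeWave q (t • r) ≠ 0 := Complex.exp_ne_zero _
    rw [h1] at h5
    exact (mul_right_cancel₀ h6 (by rw [one_mul]; exact h5)).symm
  rw [planeWave, Complex.exp_eq_one_iff] at h4
  obtain ⟨n, hn⟩ := h4
  have h7 : (inner ℝ r (t • r) : ℝ) = n := by
    have h8 : (2 * Real.pi * Complex.I : ℂ) ≠ 0 := Complex.two_pi_I_ne_zero
    have h9 : ((inner ℝ r (t • r) : ℝ) : ℂ) = (n : ℂ) := by
      apply mul_left_cancel₀ h8
      rw [hn]; ring
    exact_mod_cast h9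
  rw [inner_smul_right] at h7
  have h10 : 0 < t * inner ℝ r r := mul_pos h3 hr0
  rw [h7] at h2 h10
  norm_cast at h2 h10
  omega

/-- A trigonometric polynomial that vanishes on a set of positive measure is zero. -/
theorem planeWave_coeff_eq_zero {S : Finset (EuclideanSpace ℝ (Fin d))}
    {c : EuclideanSpace ℝ (Fin d) → ℂ}
    (h : volume {ξ : EuclideanSpace ℝ (Fin d) | ∑ q ∈ S, c q * planeWave q ξ = 0} ≠ 0) :
    ∀ q ∈ S, c q = 0 := by
  classical
  induction S using Finset.induction_on generalizing c with
  | empty => simp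
  | insert p S hp ih =>
    set Z := {ξ : EuclideanSpace ℝ (Fin d) | ∑ q ∈ insert p S, c q * planeWave q ξ = 0} with hZ
    have hZm : MeasurableSet Z := by
      refine IsClosed.measurableSet (isClosed_eq ?_ continuous_const)
      exact continuous_finsetSum _ fun q _ => continuous_const.mul (continuous_planeWave q)
    -- For small x the difference P(ξ+x) - e_p(x)P(ξ) vanishes on Z ∩ (Z - x), of positive measure,
    -- and has no frequency p. By induction c_q (e_q(x) - e_p(x)) = 0; if c_q ≠ 0, the waves e_q and
    -- e_p agree near 0, so q = p.
    have hS : ∀ q ∈ S, c q = 0 := by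
      intro q hq
      by_contra hcq
      have hpq : q = p := by
        refine planeWave_eq_of_eventually_eq ?_
        filter_upwards [eventually_measure_inter_translate_ne_zero hZm h] with x hx
        have hx' := ih (c := fun q => c q * (planeWave q x - planeWave p x)) (by
          refine fun h0 => hx (measure_mono_null ?_ h0)
          rintro ξ ⟨h1, h2⟩
          simp only [hZ, Set.mem_preimage, Set.mem_ofPred_eq, Finset.sum_insert hp] at h1 h2 ⊢
          have h3 : ∑ q ∈ S, c q * (planeWave q x - planeWave p x) * planeWave q ξ =
              (c p * planeWave p (ξ + x) + ∑ q ∈ S, c q * planeWave q (ξ + x)) -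
              planeWave p x * (c p * planeWave p ξ + ∑ q ∈ S, c q * planeWave q ξ) := by
            simp only [planeWave_add_right, mul_add, Finset.mul_sum]
            rw [show ∀ a b e f : ℂ, (a + b) - (e + f) = (a - e) + (b - f) by intros; ring,
              ← Finset.sum_sub_distrib]
            rw [show c p * (planeWave p ξ * planeWave p x) -
              planeWave p x * (c p * planeWave p ξ) = 0 by ring, zero_add]
            exact Finset.sum_congr rfl fun q _ => by ring
          rw [h3, h1, h2]; simp) q hq
        exact sub_eq_zero.1 ((mul_eq_zero.1 hx').resolve_left hcq)
      exact hp (hpq ▸ hq)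
    intro q hq
    rcases Finset.mem_insert.1 hq with rfl | hq
    · obtain ⟨ξ, hξ⟩ := nonempty_of_measure_ne_zero h
      simp only [hZ, Set.mem_ofPred_eq, Finset.sum_insert hp] at hξ
      rw [Finset.sum_eq_zero fun r hr => by rw [hS r hr, zero_mul], add_zero] at hξ
      exact (mul_eq_zero.1 hξ).resolve_right (Complex.exp_ne_zero _)
    · exact hS q hq

end TrigonometricPolynomial

/-! ### Sampling transforms, their correlation and the weights W_α -/

section Sampling

open scoped ComplexConjugate Topology Pointwise

variable {n d : ℕ} {A : Fin n → Matrix (Fin d) (Fin d) ℝ}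
  {β γ : Fin n → EuclideanSpace ℝ (Fin d)} {E F : Set (EuclideanSpace ℝ (Fin d))}

/-- The inner product is conjugate-linear in its first argument, so g is placed first. -/
theorem inner_samplingTransform (hAE : SamplingBounded A β E) (hAF : SamplingBounded A γ F)
    (f : bandSpace E) (g : bandSpace F) :
    inner ℂ (samplingTransform hAF g) (samplingTransform hAE f) =
      ∑ j, ∑' z, f.1 (samplePoint (A j) (β j) z) * conj (g.1 (samplePoint (A j) (γ j) z)) := by
  rw [PiLp.inner_apply]
  refine Finset.sum_congr rfl fun j _ => ?_
  rw [lp.inner_eq_tsum]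
  rfl

theorem norm_sq_samplingTransform (h : SamplingBounded A β E) (f : bandSpace E) :
    ‖samplingTransform h f‖ ^ 2 =
      ∑ j, ∑' z : Fin d → ℤ, ‖f.1 (samplePoint (A j) (β j) z)‖ ^ 2 := by
  rw [PiLp.norm_sq_eq_of_L2]
  refine Finset.sum_congr rfl fun j _ => ?_
  have := lp.norm_rpow_eq_tsum (p := 2) (by norm_num) (samplingTransform h f j)
  simp only [ENNReal.toReal_ofNat, Real.rpow_ofNat] at this
  exact this

theorem tendsto_samplingTransform (h : SamplingBounded A β E) {f : bandSpace E}
    {fN : ℕ → bandSpace E} (hlim : Filter.Tendsto (fun N => ∫ x, ‖(f - fN N).1 x‖ ^ 2)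
      Filter.atTop (𝓝 0)) :
    Filter.Tendsto (fun N => samplingTransform h (fN N)) Filter.atTop
      (𝓝 (samplingTransform h f)) := by
  obtain ⟨C, hC⟩ := id h
  rw [tendsto_iff_norm_sub_tendsto_zero]
  have h1 : Filter.Tendsto (fun N => ‖samplingTransform h (f - fN N)‖ ^ 2) Filter.atTop (𝓝 0) := by
    refine squeeze_zero (fun N => sq_nonneg _) (fun N => ?_) (by simpa using hlim.const_mul C)
    rw [norm_sq_samplingTransform]
    exact (hC _ (f - fN N).2).2
  have h2 := h1.sqrt
  simp only [Real.sqrt_zero, Real.sqrt_sq (norm_nonneg _), map_sub] at h2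
  simpa only [norm_sub_rev] using h2

theorem isBounded_support_indicator_closedBall (φ : EuclideanSpace ℝ (Fin d) → ℂ) (r : ℝ) :
    Bornology.IsBounded (Function.support ((Metric.closedBall 0 r).indicator φ)) :=
  Metric.isBounded_closedBall.subset Set.support_indicator_subset

/-- The sampling transform of a band-limited function is a limit of the transforms of functions
with compactly supported Fourier transform. -/
theorem exists_seq_tendsto_samplingTransform (hE : volume E < ∞) (h : SamplingBounded A β E)
    (f : bandSpace E) :
    ∃ fN : ℕ → bandSpace E, (∀ N, ∃ φ : EuclideanSpace ℝ (Fin d) → ℂ, MemLp φ 2 volume ∧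
      (∀ᵐ ξ, ξ ∉ E → φ ξ = 0) ∧ Bornology.IsBounded (Function.support φ) ∧
      (fN N).1 = 𝓕⁻ φ) ∧
      Filter.Tendsto (fun N => samplingTransform h (fN N)) Filter.atTop
        (𝓝 (samplingTransform h f)) := by
  obtain ⟨φ, hφ, h0, hf⟩ := exists_fourierInv_eq hE f.2
  set B : ℕ → Set (EuclideanSpace ℝ (Fin d)) := fun N => Metric.closedBall 0 N
  have hBm : ∀ N, MeasurableSet (B N) := fun N => Metric.isClosed_closedBall.measurableSet
  have hφN : ∀ N, MemLp ((B N).indicator φ) 2 volume := fun N => hφ.indicator (hBm N)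
  have h0N : ∀ N, ∀ᵐ ξ, ξ ∉ E → (B N).indicator φ ξ = 0 := fun N => by
    filter_upwards [h0] with ξ hξ hE
    rw [Set.indicator_apply_eq_zero]
    exact fun _ => hξ hE
  refine ⟨fun N => ⟨𝓕⁻ ((B N).indicator φ), fourierInv_mem_bandSpace hE (hφN N) (h0N N)⟩,
    fun N => ⟨_, hφN N, h0N N, isBounded_support_indicator_closedBall φ N, rfl⟩, ?_⟩
  have hφ1 := integrable_of_memLp_of_ae_zero hE hφ h0
  refine tendsto_samplingTransform h ?_
  have hdiff : ∀ N, φ - (B N).indicator φ = (B N)ᶜ.indicator φ := fun N =>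
    sub_eq_iff_eq_add.2 (Set.indicator_compl_add_self _ _).symm
  -- By Plancherel the squared L² error is the mass of φ outside the ball, which tends to 0 by
  -- dominated convergence.
  have h1 : ∀ N, ∫ x, ‖(f - ⟨𝓕⁻ ((B N).indicator φ),
      fourierInv_mem_bandSpace hE (hφN N) (h0N N)⟩ : bandSpace E).1 x‖ ^ 2 =
      ∫ ξ, ‖(B N)ᶜ.indicator φ ξ‖ ^ 2 := fun N => by
    rw [← integral_norm_sq_fourierInv (hφ.indicator (hBm N).compl)
      (hφ1.indicator (hBm N).compl), ← hdiff]
    congr 1 with x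
    congr 2
    have e : (f - ⟨𝓕⁻ ((B N).indicator φ),
      fourierInv_mem_bandSpace hE (hφN N) (h0N N)⟩ : bandSpace E).1 x =
      𝓕⁻ φ x - 𝓕⁻ ((B N).indicator φ) x := by rw [← hf]; rfl
    rw [e]
    simp only [fourierInv_apply_eq]
    have hint : ∀ {w : EuclideanSpace ℝ (Fin d) → ℂ}, Integrable w →
        Integrable fun ξ => planeWave x ξ * w ξ := fun hw =>
      hw.bdd_mul (c := 1) (continuous_planeWave x).aestronglyMeasurable
        (Filter.Eventually.of_forall fun ξ => (norm_planeWave x ξ).le)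
    rw [← integral_sub (hint hφ1) (hint (hφ1.indicator (hBm N)))]
    simp only [Pi.sub_apply, mul_sub]
  simp_rw [h1]
  have hz : (0 : ℝ) = ∫ _ : EuclideanSpace ℝ (Fin d), (0 : ℝ) := by simp
  rw [hz]
  refine tendsto_integral_of_dominated_convergence (fun ξ => ‖φ ξ‖ ^ 2)
    (fun N => ((hφ.indicator (hBm N).compl).1.norm.pow 2)) ?_ (fun N => ?_) ?_
  · exact hφ.integrable_norm_pow (by norm_num)
  · refine Filter.Eventually.of_forall fun ξ => ?_
    rw [Real.norm_of_nonneg (sq_nonneg _)]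
    gcongr
    exact norm_indicator_le_norm_self _ _
  · refine Filter.Eventually.of_forall fun ξ => ?_
    refine tendsto_const_nhds.congr' ?_
    filter_upwards [Filter.eventually_ge_atTop ⌈‖ξ‖⌉₊] with N hN
    rw [Set.indicator_of_notMem]
    · simp
    · rw [Set.notMem_compl_iff, mem_closedBall_zero_iff]
      exact (Nat.le_ceil _).trans (by exact_mod_cast hN)

theorem finite_dualUnion_inter (hA : ∀ j, IsUnit (A j)) {S : Set (EuclideanSpace ℝ (Fin d))}
    (hS : Bornology.IsBounded S) : (dualUnion A ∩ S).Finite := by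
  rw [dualUnion, Set.iUnion_inter]
  refine Set.finite_iUnion fun j => ?_
  refine ((finite_dualMap_intVec_mem (hA j) hS).image fun k => dualMap (A j) (intVec k)).subset ?_
  rintro _ ⟨⟨k, rfl⟩, hk⟩
  exact ⟨k, hk, rfl⟩

theorem mem_dualIndices_iff (hA : ∀ j, IsUnit (A j)) {α : EuclideanSpace ℝ (Fin d)} {j : Fin n} :
    j ∈ dualIndices A α ↔ α ∈ Set.range fun k => dualMap (A j) (intVec k) := by
  constructor
  · rintro ⟨z, hz⟩
    exact ⟨z, by rw [← dualMap_transpose_mulVec (hA j) α, hz]; rfl⟩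
  · rintro ⟨k, rfl⟩
    exact ⟨k, transpose_mulVec_dualMap (hA j) _⟩

/-- The coefficient `∑_{j ∈ I_{q,α}} |det A_j|⁻¹ e^{-2πi γ_j·α}`. -/
noncomputable def shiftCoeff (A : Fin n → Matrix (Fin d) (Fin d) ℝ)
    (β γ : Fin n → EuclideanSpace ℝ (Fin d)) (α q : EuclideanSpace ℝ (Fin d)) : ℂ :=
  ∑ j ∈ shiftIndices A β γ q α, ((|(A j).det|⁻¹ : ℝ) : ℂ) *
    Complex.exp (-2 * Real.pi * Complex.I * ((inner ℝ (γ j) α : ℝ) : ℂ))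

theorem exp_neg_eq_planeWave (δ α : EuclideanSpace ℝ (Fin d)) :
    Complex.exp (-2 * Real.pi * Complex.I * ((inner ℝ δ α : ℝ) : ℂ)) = planeWave (-δ) α := by
  rw [planeWave, inner_neg_left]
  push_cast; ring_nf

theorem neg_mem_dualUnion {α : EuclideanSpace ℝ (Fin d)} (hα : α ∈ dualUnion A) :
    -α ∈ dualUnion A := by
  obtain ⟨j, k, rfl⟩ := Set.mem_iUnion.1 hα
  refine Set.mem_iUnion.2 ⟨j, -k, ?_⟩
  have : (fun i => ((-k) i : ℝ)) = -fun i => (k i : ℝ) := by ext i; simp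
  simp only [this, Matrix.mulVec_neg]
  rfl

theorem dualIndices_neg_subset (α : EuclideanSpace ℝ (Fin d)) :
    dualIndices A α ⊆ dualIndices A (-α) := by
  rintro j ⟨z, hz⟩
  refine ⟨-z, ?_⟩
  rw [WithLp.ofLp_neg, Matrix.mulVec_neg, hz]
  ext i; simp

theorem dualIndices_neg (α : EuclideanSpace ℝ (Fin d)) :
    dualIndices A (-α) = dualIndices A α := by
  refine Set.Subset.antisymm ?_ (dualIndices_neg_subset α)
  simpa using dualIndices_neg_subset (A := A) (-α)

/-- Needed because the correlation term at α involves E ∩ (F - α), while the theorem's condition (1)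
at α involves E ∩ (F + α). -/
theorem shiftCoeff_neg (α q : EuclideanSpace ℝ (Fin d)) :
    shiftCoeff A β γ (-α) q = conj (shiftCoeff A β γ α q) := by
  have hI : shiftIndices A β γ q (-α) = shiftIndices A β γ q α := by
    ext j
    simp [shiftIndices, dualIndices_neg]
  simp only [shiftCoeff, exp_neg_eq_planeWave, hI, map_sum, map_mul, Complex.conj_ofReal,
    conj_planeWave']

open Classical in
/-- The trigonometric polynomial that weights the correlation of the bands at the shift `α`. -/
noncomputable def shiftWeight (A : Fin n → Matrix (Fin d) (Fin d) ℝ)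
    (β γ : Fin n → EuclideanSpace ℝ (Fin d)) (α ξ : EuclideanSpace ℝ (Fin d)) : ℂ :=
  ∑ q ∈ Finset.univ.image fun j => β j - γ j, shiftCoeff A β γ α (-q) * planeWave q ξ

theorem continuous_shiftWeight (α : EuclideanSpace ℝ (Fin d)) :
    Continuous (shiftWeight A β γ α) :=
  continuous_finsetSum _ fun q _ => continuous_const.mul (continuous_planeWave q)

-- The wave of index j has frequency β_j - γ_j, and splitting off the shift leaves the constant
-- e^{-2πi γ_j·α}. Grouping by frequency q collects the j with γ_j - β_j = -q.
open Classical in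
theorem sum_planeWave_eq_shiftWeight (hA : ∀ j, IsUnit (A j)) (α ξ : EuclideanSpace ℝ (Fin d)) :
    ∑ j, (if α ∈ Set.range (fun k => dualMap (A j) (intVec k)) then
      ((|(A j).det|⁻¹ : ℝ) : ℂ) * (planeWave (β j) ξ * conj (planeWave (γ j) (ξ + α))) else 0) =
      shiftWeight A β γ α ξ := by
  rw [shiftWeight, ← Finset.sum_fiberwise_of_maps_to (s := Finset.univ)
    (t := Finset.univ.image fun j => β j - γ j) (g := fun j => β j - γ j)
    (fun j _ => Finset.mem_image_of_mem _ (Finset.mem_univ j))]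
  refine Finset.sum_congr rfl fun q _ => ?_
  rw [shiftCoeff, Finset.sum_mul, shiftIndices, ← Finset.sum_filter, Finset.filter_filter]
  refine Finset.sum_congr ?_ fun j hj => ?_
  · ext j
    simp only [Finset.mem_filter, Finset.mem_univ, true_and, mem_dualIndices_iff hA]
    rw [and_comm, ← neg_sub (β j) (γ j), neg_inj]
  · have hq : β j - γ j = q := by
      have := (Finset.mem_filter.1 hj).2.2
      rw [← neg_sub, this, neg_neg]
    rw [exp_neg_eq_planeWave, conj_planeWave, planeWave_add_right, ← hq, sub_eq_add_neg,
      planeWave_add_left]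
    ring

/-- The inner product of the transforms of two functions with compactly supported Fourier
transforms. -/
theorem inner_samplingTransform_eq_sum (hA : ∀ j, IsUnit (A j)) (hAE : SamplingBounded A β E)
    (hAF : SamplingBounded A γ F) {f : bandSpace E} {g : bandSpace F}
    {φ ψ : EuclideanSpace ℝ (Fin d) → ℂ} (hf : f.1 = 𝓕⁻ φ) (hg : g.1 = 𝓕⁻ ψ)
    (hφ : MemLp φ 2 volume) (hψ : MemLp ψ 2 volume) (hφ1 : Integrable φ) (hψ1 : Integrable ψ)
    (hφb : Bornology.IsBounded (Function.support φ))
    (hψb : Bornology.IsBounded (Function.support ψ)) {R : Finset (EuclideanSpace ℝ (Fin d))}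
    (hR : ∀ α ∈ dualUnion A, ∀ ξ, φ ξ ≠ 0 → ψ (ξ + α) ≠ 0 → α ∈ R) :
    inner ℂ (samplingTransform hAF g) (samplingTransform hAE f) =
      ∑ α ∈ R, ∫ ξ, φ ξ * conj (ψ (ξ + α)) * shiftWeight A β γ α ξ := by
  classical
  have hsum := fun j => (hasSum_samples (A := A j) (β := β j) (γ := γ j) (hA j) hφ hψ hφ1 hψ1
    hφb hψb (R := R) fun k ξ h1 h2 => hR _ (Set.mem_iUnion.2 ⟨j, k, rfl⟩) ξ h1 h2).tsum_eq
  rw [inner_samplingTransform, hf, hg, Finset.sum_congr rfl fun j _ => hsum j, Finset.sum_comm]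
  refine Finset.sum_congr rfl fun α _ => ?_
  have hP : Integrable fun ξ => φ ξ * conj (ψ (ξ + α)) :=
    hφ.integrable_mul (hψ.comp_measurePreserving (measurePreserving_add_right volume α)).star
  set b : Fin n → EuclideanSpace ℝ (Fin d) → ℂ := fun j ξ =>
    if α ∈ Set.range (fun k => dualMap (A j) (intVec k)) then
      ((|(A j).det|⁻¹ : ℝ) : ℂ) * (planeWave (β j) ξ * conj (planeWave (γ j) (ξ + α))) else 0
    with hb
  have hbc : ∀ j, Continuous (b j) := fun j => by
    by_cases h : α ∈ Set.range (fun k => dualMap (A j) (intVec k))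
    · simp only [hb, if_pos h]
      exact continuous_const.mul ((continuous_planeWave _).mul (Complex.continuous_conj.comp
        ((continuous_planeWave _).comp (continuous_id.add continuous_const))))
    · simp only [hb, if_neg h]
      exact continuous_const
  have hbb : ∀ j ξ, ‖b j ξ‖ ≤ |(A j).det|⁻¹ := fun j ξ => by
    simp only [hb]
    split_ifs
    · simp [norm_planeWave]
    · simp
  have hint : ∀ j, Integrable fun ξ => φ ξ * conj (ψ (ξ + α)) * b j ξ := fun j =>
    hP.mul_bdd (hbc j).aestronglyMeasurable (Filter.Eventually.of_forall (hbb j))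
  have hW : ∀ ξ, shiftWeight A β γ α ξ = ∑ j, b j ξ := fun ξ =>
    (sum_planeWave_eq_shiftWeight hA α ξ).symm
  simp_rw [hW, Finset.mul_sum]
  rw [integral_finsetSum _ fun j _ => hint j]
  refine Finset.sum_congr rfl fun j _ => ?_
  simp only [hb]
  split_ifs with h
  · congr 1 with ξ
    rw [map_mul]
    ring
  · simp

/-! ### The two directions of the equivalence -/

theorem orthogonalSamples_iff_inner (hAE : SamplingBounded A β E) (hAF : SamplingBounded A γ F) :
    OrthogonalSamples hAE hAF ↔ ∀ (f : bandSpace E) (g : bandSpace F),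
      inner ℂ (samplingTransform hAF g) (samplingTransform hAE f) = 0 := by
  rw [OrthogonalSamples, Submodule.isOrtho_iff_inner_eq]
  constructor
  · intro h f g
    rw [← inner_conj_symm, h _ (LinearMap.mem_range_self _ f) _ (LinearMap.mem_range_self _ g),
      map_zero]
  · rintro h _ ⟨f, rfl⟩ _ ⟨g, rfl⟩
    rw [← inner_conj_symm, h, map_zero]

theorem orthogonalSamples_of_shiftCoeff (hE : volume E < ∞) (hF : volume F < ∞)
    (hA : ∀ j, IsUnit (A j)) (hAE : SamplingBounded A β E) (hAF : SamplingBounded A γ F)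
    (h : ∀ α ∈ dualUnion A, volume (E ∩ ((fun x => x + α) '' F)) = 0 ∨
      ∀ q, shiftCoeff A β γ α q = 0) : OrthogonalSamples hAE hAF := by
  classical
  rw [orthogonalSamples_iff_inner]
  intro f g
  obtain ⟨fN, hfN, hflim⟩ := exists_seq_tendsto_samplingTransform hE hAE f
  obtain ⟨gN, hgN, hglim⟩ := exists_seq_tendsto_samplingTransform hF hAF g
  refine tendsto_nhds_unique (hglim.inner hflim) (tendsto_const_nhds.congr fun N => ?_)
  obtain ⟨φ, hφ, hφ0, hφb, hf⟩ := hfN N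
  obtain ⟨ψ, hψ, hψ0, hψb, hg⟩ := hgN N
  -- Only shifts in this difference set can contribute, and Λ has finitely many points in it.
  have hb : Bornology.IsBounded (Function.support ψ - Function.support φ) := hψb.sub hφb
  have hfin := finite_dualUnion_inter hA hb
  rw [inner_samplingTransform_eq_sum hA hAE hAF hf hg hφ hψ
    (integrable_of_memLp_of_ae_zero hE hφ hφ0) (integrable_of_memLp_of_ae_zero hF hψ hψ0) hφb hψb
    (R := hfin.toFinset) fun α hα ξ h1 h2 => by
      rw [Set.Finite.mem_toFinset]
      exact ⟨hα, Set.mem_sub.2 ⟨ξ + α, h2, ξ, h1, by simp⟩⟩]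
  refine (Finset.sum_eq_zero fun α hα => ?_).symm
  have hαΛ : α ∈ dualUnion A := ((Set.Finite.mem_toFinset _).1 hα).1
  -- A nonzero integrand needs, almost everywhere, ξ in E and ξ + α in F, that is, ξ in E ∩ (F - α).
  rcases h (-α) (neg_mem_dualUnion hαΛ) with h0 | h0
  · refine integral_eq_zero_of_ae ?_
    have hψ0' := (measurePreserving_add_right (volume : Measure (EuclideanSpace ℝ (Fin d)))
      α).quasiMeasurePreserving.ae hψ0
    filter_upwards [hφ0, hψ0', measure_eq_zero_iff_ae_notMem.1 h0] with ξ h1 h2 h3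
    by_cases hξE : ξ ∈ E
    · have : ξ + α ∉ F := fun hF => h3 ⟨hξE, ξ + α, hF, by simp⟩
      simp [h2 this]
    · simp [h1 hξE]
  · have hW : ∀ ξ, shiftWeight A β γ α ξ = 0 := fun ξ => Finset.sum_eq_zero fun q _ => by
      have := shiftCoeff_neg (A := A) (β := β) (γ := γ) (-α) (-q)
      rw [neg_neg, h0, map_zero] at this
      rw [this, zero_mul]
    simp [hW]

theorem exists_pos_forall_dualUnion_eq (hA : ∀ j, IsUnit (A j)) (α : EuclideanSpace ℝ (Fin d)) :
    ∃ r > 0, ∀ a ∈ dualUnion A, dist a α < r → a = α := by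
  have hfin := finite_dualUnion_inter hA (Metric.isBounded_ball (x := α) (r := 1))
  have hopen : IsOpen ((dualUnion A ∩ Metric.ball α 1) \ {α})ᶜ :=
    (hfin.sdiff).isClosed.isOpen_compl
  obtain ⟨ε, hε, hball⟩ := Metric.isOpen_iff.1 hopen α (by simp)
  refine ⟨min ε 1, lt_min hε one_pos, fun a ha hd => ?_⟩
  by_contra hne
  exact hball (Metric.mem_ball.2 (hd.trans_le (min_le_left _ _)))
    ⟨⟨ha, Metric.mem_ball.2 (hd.trans_le (min_le_right _ _))⟩, hne⟩

theorem shiftCoeff_eq_zero_of_orthogonalSamples (hE : NullMeasurableSet E volume)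
    (hE_fin : volume E < ∞) (hF : NullMeasurableSet F volume) (hF_fin : volume F < ∞)
    (hA : ∀ j, IsUnit (A j)) {hAE : SamplingBounded A β E} {hAF : SamplingBounded A γ F}
    (h : OrthogonalSamples hAE hAF) {α : EuclideanSpace ℝ (Fin d)}
    (hpos : volume (E ∩ ((fun x => x + α) '' F)) ≠ 0) (q : EuclideanSpace ℝ (Fin d)) :
    shiftCoeff A β γ α q = 0 := by
  classical
  rw [orthogonalSamples_iff_inner] at h
  obtain ⟨r, hr, hiso⟩ := exists_pos_forall_dualUnion_eq hA (-α)
  -- Around c every neighbourhood meets E ∩ (F+α) in positive measure, so H can be chosen inside a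
  -- ball of radius r/2, with r isolating -α in Λ.
  obtain ⟨c, hc, hcpos⟩ := exists_mem_forall_mem_nhdsWithin_pos_measure hpos
  set G := E ∩ ((fun x => x + α) '' F)
  have hGm : NullMeasurableSet G volume := by
    refine hE.inter ?_
    rw [Set.image_add_right]
    exact hF.preimage (measurePreserving_add_right volume (-α)).quasiMeasurePreserving
  have hball : 0 < volume (G ∩ Metric.ball c (r / 2)) :=
    hcpos _ (inter_mem_nhdsWithin _ (Metric.ball_mem_nhds c (half_pos hr)))
  obtain ⟨H, hHG, hHm, hHae⟩ := (hGm.inter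
    (measurableSet_ball.nullMeasurableSet (s := Metric.ball c (r / 2)))).exists_measurable_subset_ae_eq
  have hH0 : volume H ≠ 0 := by rw [measure_congr hHae]; exact hball.ne'
  have hHb : Bornology.IsBounded H := Metric.isBounded_ball.subset fun x hx => (hHG hx).2
  have hHfin : volume H < ∞ := hHb.measure_lt_top
  set W := shiftWeight A β γ (-α) with hW
  have hWc : Continuous W := continuous_shiftWeight _
  -- On H the surviving integrand φ(ξ) conj ψ(ξ-α) W(ξ) becomes |W|².
  set φ : EuclideanSpace ℝ (Fin d) → ℂ := H.indicator fun ξ => conj (W ξ) with hφdef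
  set ψ : EuclideanSpace ℝ (Fin d) → ℂ := fun η => H.indicator (fun _ => (1 : ℂ)) (η + α) with hψdef
  have hind : MemLp (H.indicator fun _ => (1 : ℂ)) 2 volume :=
    memLp_indicator_const 2 hHm 1 (Or.inr hHfin.ne)
  have hφ : MemLp φ 2 volume := by
    obtain ⟨C, hC⟩ := hHb.isCompact_closure.exists_bound_of_continuousOn hWc.continuousOn
    refine (memLp_indicator_const 2 hHm (C : ℝ) (Or.inr hHfin.ne)).of_le
      ((Complex.continuous_conj.comp hWc).aestronglyMeasurable.indicator hHm)
      (Filter.Eventually.of_forall fun ξ => ?_)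
    by_cases hξ : ξ ∈ H
    · rw [hφdef, Set.indicator_of_mem hξ, Set.indicator_of_mem hξ, RCLike.norm_conj]
      exact (hC ξ (subset_closure hξ)).trans (le_abs_self _)
    · simp [hφdef, hξ]
  have hψ : MemLp ψ 2 volume :=
    hind.comp_measurePreserving (measurePreserving_add_right volume α)
  have hφ0 : ∀ᵐ ξ, ξ ∉ E → φ ξ = 0 := Filter.Eventually.of_forall fun ξ hξ =>
    Set.indicator_of_notMem (fun hm => hξ (hHG hm).1.1) _
  have hψ0 : ∀ᵐ ξ, ξ ∉ F → ψ ξ = 0 := Filter.Eventually.of_forall fun ξ hξ => by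
    refine Set.indicator_of_notMem (fun hm => ?_) _
    obtain ⟨x, hx, hxe⟩ := (hHG hm).1.2
    exact hξ (add_right_cancel hxe ▸ hx)
  have hφb : Bornology.IsBounded (Function.support φ) :=
    hHb.subset Set.support_indicator_subset
  have hψb : Bornology.IsBounded (Function.support ψ) := by
    refine ((isometry_add_right (-α)).lipschitz.isBounded_image hHb).subset fun η hη => ?_
    refine ⟨η + α, ?_, by simp⟩
    by_contra hn
    exact hη (Set.indicator_of_notMem hn _)
  have hinner := inner_samplingTransform_eq_sum hA hAE hAF
    (f := ⟨_, fourierInv_mem_bandSpace hE_fin hφ hφ0⟩)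
    (g := ⟨_, fourierInv_mem_bandSpace hF_fin hψ hψ0⟩) rfl rfl hφ hψ
    (integrable_of_memLp_of_ae_zero hE_fin hφ hφ0) (integrable_of_memLp_of_ae_zero hF_fin hψ hψ0)
    hφb hψb (R := {-α}) fun a ha ξ h1 h2 => by
      rw [Finset.mem_singleton]
      refine hiso a ha ?_
      -- Both ξ and ξ + a + α lie in H, so a is within r of -α.
      have hξ : ξ ∈ H := by
        by_contra hn
        exact h1 (Set.indicator_of_notMem hn _)
      have hξ' : ξ + a + α ∈ H := by
        by_contra hn
        exact h2 (Set.indicator_of_notMem hn _)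
      have e : dist a (-α) = dist (ξ + a + α) ξ := by
        rw [dist_eq_norm, dist_eq_norm]; congr 1; abel
      rw [e]
      calc dist (ξ + a + α) ξ ≤ dist (ξ + a + α) c + dist ξ c := dist_triangle_right _ _ _
        _ < r / 2 + r / 2 := add_lt_add (hHG hξ').2 (hHG hξ).2
        _ = r := add_halves r
  rw [h, Finset.sum_singleton] at hinner
  have hsq : ∀ ξ, φ ξ * conj (ψ (ξ + -α)) * W ξ = ((‖φ ξ‖ ^ 2 : ℝ) : ℂ) := fun ξ => by
    by_cases hξ : ξ ∈ H
    · simp only [hφdef, hψdef, neg_add_cancel_right, Set.indicator_of_mem hξ, map_one, mul_one,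
        RCLike.norm_conj]
      rw [mul_comm, Complex.mul_conj, Complex.normSq_eq_norm_sq]
    · simp [hφdef, hξ]
  simp_rw [← hW, hsq] at hinner
  rw [integral_complex_ofReal] at hinner
  have hint0 : ∫ ξ, ‖φ ξ‖ ^ 2 = 0 := by exact_mod_cast hinner.symm
  rw [integral_eq_zero_iff_of_nonneg (fun ξ => sq_nonneg _)
    (hφ.integrable_norm_pow (by norm_num))] at hint0
  have hzero : volume {ξ | W ξ = 0} ≠ 0 := by
    refine fun h0 => hH0 (le_antisymm ?_ zero_le)
    refine (measure_mono_ae ?_).trans h0.le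
    filter_upwards [hint0] with ξ hξ hmem
    have h1 : φ ξ = 0 := by simpa using hξ
    have h2 : W ξ = 0 := by simpa [hφdef, Set.indicator_of_mem (show ξ ∈ H from hmem)] using h1
    exact h2
  have hcoef := planeWave_coeff_eq_zero hzero
  by_cases hq : -q ∈ Finset.univ.image fun j => β j - γ j
  · have h1 := hcoef _ hq
    rw [neg_neg, shiftCoeff_neg] at h1
    exact (map_eq_zero _).1 h1
  -- If no j has γ_j - β_j = q, the sum is empty.
  · refine Finset.sum_eq_zero fun j hj => (hq ?_).elim
    rw [← (Finset.mem_filter.1 hj).2.2, neg_sub]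
    exact Finset.mem_image_of_mem _ (Finset.mem_univ j)

/-- At α = 0 all exponentials are 1, so the coefficient is a nonempty sum of positive numbers:
condition (2) fails there. -/
theorem shiftCoeff_zero_ne_zero (hA : ∀ j, IsUnit (A j)) (j : Fin n) :
    shiftCoeff A β γ 0 (γ j - β j) ≠ 0 := by
  have hdet : ∀ i, 0 < |(A i).det|⁻¹ := fun i =>
    inv_pos.2 (abs_pos.2 ((Matrix.isUnit_iff_isUnit_det _).1 (hA i)).ne_zero)
  have hj : j ∈ shiftIndices A β γ (γ j - β j) 0 := by
    simp only [shiftIndices, Finset.mem_filter, Finset.mem_univ, true_and, and_true]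
    exact ⟨0, by ext; simp⟩
  simp only [shiftCoeff, inner_zero_right, Complex.ofReal_zero, mul_zero, Complex.exp_zero,
    mul_one]
  rw [← Complex.ofReal_sum, Complex.ofReal_ne_zero]
  exact (Finset.sum_pos (fun i _ => hdet i) ⟨j, hj⟩).ne'

end Sampling

theorem theorem3 {n d : ℕ} (hn : 0 < n)
    (E F : Set (EuclideanSpace ℝ (Fin d)))
    (hE : NullMeasurableSet E volume) (hE_fin : volume E < ∞)
    (hF : NullMeasurableSet F volume) (hF_fin : volume F < ∞)
    (A : Fin n → Matrix (Fin d) (Fin d) ℝ) (hA : ∀ j, IsUnit (A j))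
    (β γ : Fin n → EuclideanSpace ℝ (Fin d))
    (hAE : SamplingBounded A β E) (hAF : SamplingBounded A γ F) :
    (OrthogonalSamples hAE hAF ↔
      ∀ α ∈ dualUnion A,
        volume (E ∩ ((fun x => x + α) '' F)) = 0 ∨
        ∀ q : EuclideanSpace ℝ (Fin d),
          ∑ j ∈ shiftIndices A β γ q α,
            ((|(A j).det|⁻¹ : ℝ) : ℂ) *
              Complex.exp (-2 * Real.pi * Complex.I * ((inner ℝ (γ j) α : ℝ) : ℂ)) = 0) ∧
    (OrthogonalSamples hAE hAF → volume (E ∩ F) = 0) := by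
  refine ⟨⟨fun h α _ => or_iff_not_imp_left.2 fun hpos q => ?_, fun h => ?_⟩, fun h => ?_⟩
  · exact shiftCoeff_eq_zero_of_orthogonalSamples hE hE_fin hF hF_fin hA h hpos q
  · exact orthogonalSamples_of_shiftCoeff hE_fin hF_fin hA hAE hAF h
  · by_contra hpos
    refine shiftCoeff_zero_ne_zero (β := β) (γ := γ) hA ⟨0, hn⟩ ?_
    exact shiftCoeff_eq_zero_of_orthogonalSamples hE hE_fin hF hF_fin hA h (by simpa using hpos) _
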